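/- Let $\mathbb T=\mathbb R/2\pi\mathbb Z$ be the unit circle, $\Omega=\mathbb T\times(0,1)$ with points $z=(\theta,r)$ and measure $dz=d\theta\,dr$, $\Gamma=\mathbb T\times\{1\}$, $\Gamma^*=\mathbb T\times\{0\}$. Let $\alpha\in[1,2)$, $w=r^\alpha$, $A=\operatorname{diag}(1,r^\alpha)$ and $\mathcal A u=-\operatorname{div}(A\nabla u)=-\partial_{\theta\theta}u-\partial_r(r^\alpha\partial_r u)$; all derivatives are in the sense of distributions on $\Omega$. Let $$H^1(\Omega;w)=\Big\{u\in L^2(\Omega):\int_\Omega \nabla u\cdot A\nabla u\,dz<\infty\Big\},\qquad \|u\|_{H^1(\Omega;w)}^2=\int_\Omega(\nabla u\cdot A\nabla u+u^2)\,dz,$$ let $H^1_\Gamma(\Omega;w)$ be the closure in $H^1(\Omega;w)$ of the functions in $C^\infty(\overline\Omega)$ that vanish in a neighbourhood of $\Gamma$, and let $H^2(\Omega;w)=\{u\in H^1(\Omega;w):\mathcal A u\in L^2(\Omega)\}$. For $g\in L^2(\Omega)$, a weak solution of the degenerate elliptic problem $$\mathcal A u=g\ \text{ in }\Omega,\qquad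 u=0\ \text{ on }\Gamma,\qquad \frac{\partial u}{\partial\nu_A}=0\ \text{ on }\Gamma^*$$ is a function $u\in H^1_\Gamma(\Omega;w)\cap H^2(\Omega;w)$ with $\int_\Omega\nabla u\cdot A\nabla v\,dz=\int_\Omega g v\,dz$ for all $v\in H^1_\Gamma(\Omega;w)$. **Theorem 2.20.** There is a constant $C>0$, depending only on $\alpha$, such that for every $g\in L^2(\Omega)$ and every weak solution $u$ of the above problem, $$\partial_{\theta\theta}u\in L^2(\Omega),\qquad r^{\alpha/2}\,\partial_{\theta r}u\in L^2(\Omega),\qquad r^{1+\alpha/2}\,\partial_{rr}u\in L^2(\Omega),$$ and $$\int_\Omega\big[(\partial_{\theta\theta}u)^2+r^\alpha(\partial_{\theta r}u)^2+r^{2+\alpha}(\partial_{rr}u)^2\big]\,dz\le C\int_\Omega g^2\,dz .$$ -/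

import Mathlib

open MeasureTheory Set
open scoped Real ContDiff

noncomputable section

namespace DegenerateElliptic

instance factTwoPiPos : Fact (0 < 2 * π) := ⟨Real.two_pi_pos⟩

/-- The infinite cylinder `𝕋 × ℝ`, where `𝕋 = ℝ / 2πℤ` is the unit circle parametrized by the
angle `θ`; it carries the product of arc length and Lebesgue measure. A point is `z = (θ, r)`. -/
abbrev Cyl : Type := AddCircle (2 * π) × ℝ

/-- `Ω = 𝕋 × (0, 1)`. -/
def Omega : Set Cyl := univ ×ˢ Ioo (0 : ℝ) 1

/-- The measure `dz` on `Ω`. -/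
def dz : Measure Cyl := (volume : Measure Cyl).restrict Omega

/-- The space `L²(Ω)` (through representatives). -/
def MemL2 (u : Cyl → ℝ) : Prop := MemLp u 2 dz

/-- Smooth functions on `𝕋 × ℝ`: the `2π`-periodic lift to `ℝ × ℝ` is smooth. -/
def IsSmooth (φ : Cyl → ℝ) : Prop :=
  ContDiff ℝ ∞ fun p : ℝ × ℝ => φ ((p.1 : AddCircle (2 * π)), p.2)

/-- The classical angular derivative `∂_θ φ`. -/
def dTheta (φ : Cyl → ℝ) : Cyl → ℝ :=
  fun z => deriv (fun t : ℝ => φ (z.1 + (t : AddCircle (2 * π)), z.2)) 0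

/-- The classical radial derivative `∂_r φ`. -/
def dR (φ : Cyl → ℝ) : Cyl → ℝ := fun z => deriv (fun s : ℝ => φ (z.1, s)) z.2

/-- Test functions: `C_0^∞(Ω)`. -/
def IsTest (φ : Cyl → ℝ) : Prop :=
  IsSmooth φ ∧ HasCompactSupport φ ∧ tsupport φ ⊆ Omega

/-- `v = ∂_θ^i ∂_r^j u` on `Ω` in the sense of distributions, with `u, v ∈ L¹_loc(Ω)`. -/
def HasWeakDeriv (i j : ℕ) (u v : Cyl → ℝ) : Prop :=
  LocallyIntegrableOn u Omega ∧ LocallyIntegrableOn v Omega ∧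
    ∀ φ : Cyl → ℝ, IsTest φ →
      ∫ z, u z * (dTheta^[i] (dR^[j] φ)) z ∂dz = (-1) ^ (i + j) * ∫ z, v z * φ z ∂dz

/-- `u ∈ H¹(Ω; w)`, `w = r ^ α`, and its weak gradient is `∇u = (p, q)`:
`u ∈ L²(Ω)` and `∇u · A∇u = p² + r ^ α q²` is integrable, `A = diag(1, r ^ α)`. -/
structure HasWGrad (α : ℝ) (u p q : Cyl → ℝ) : Prop where
  memL2 : MemL2 u
  weak_theta : HasWeakDeriv 1 0 u p
  weak_r : HasWeakDeriv 0 1 u q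
  memL2_theta : MemL2 p
  memL2_r : MemL2 fun z => z.2 ^ (α / 2) * q z

/-- The space `C_Γ^∞(Ω)`: smooth up to the boundary (as the restriction of a smooth function on
`𝕋 × ℝ`) and vanishing on `Ω` near `Γ = 𝕋 × {1}`. -/
def IsSmoothGamma (φ : Cyl → ℝ) : Prop :=
  IsSmooth φ ∧ ∃ δ > (0 : ℝ), ∀ z : Cyl, 1 - δ < z.2 → z.2 ≤ 1 → φ z = 0

/-- The space `H¹_Γ(Ω; w)`: the closure of `C_Γ^∞(Ω)` in `H¹(Ω; w)`. -/
def MemH1Gamma (α : ℝ) (u : Cyl → ℝ) : Prop :=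
  ∃ p q : Cyl → ℝ, HasWGrad α u p q ∧
    ∀ ε > (0 : ℝ), ∃ φ : Cyl → ℝ, IsSmoothGamma φ ∧
      ∫ z, ((p z - dTheta φ z) ^ 2 + z.2 ^ α * (q z - dR φ z) ^ 2 + (u z - φ z) ^ 2) ∂dz < ε

/-- The space `H²(Ω; w)`: `u ∈ H¹(Ω; w)` and the distribution `𝒜u = -div (A∇u)` lies in
`L²(Ω)`. -/
def MemH2 (α : ℝ) (u : Cyl → ℝ) : Prop :=
  ∃ p q : Cyl → ℝ, HasWGrad α u p q ∧
    ∃ f : Cyl → ℝ, MemL2 f ∧ ∀ φ : Cyl → ℝ, IsTest φ →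
      ∫ z, (p z * dTheta φ z + z.2 ^ α * q z * dR φ z) ∂dz = ∫ z, f z * φ z ∂dz

/-- `u` is a weak solution of `𝒜u = g` in `Ω`, `u = 0` on `Γ`, `∂u/∂ν_A = 0` on `Γ* = 𝕋 × {0}`:
`u ∈ H¹_Γ(Ω; w) ∩ H²(Ω; w)` and `∫_Ω ∇u · A∇v = ∫_Ω g v` for all `v ∈ H¹_Γ(Ω; w)`.
(Weak gradients are unique almost everywhere, so the quantifiers over `p, q, p', q'` only name
`∇u` and `∇v`.) -/
structure IsWeakSolution (α : ℝ) (g u : Cyl → ℝ) : Prop where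
  memH1Gamma : MemH1Gamma α u
  memH2 : MemH2 α u
  weak_eq : ∀ p q : Cyl → ℝ, HasWGrad α u p q →
    ∀ v p' q' : Cyl → ℝ, MemH1Gamma α v → HasWGrad α v p' q' →
      ∫ z, (p z * p' z + z.2 ^ α * q z * q' z) ∂dz = ∫ z, g z * v z ∂dz

end DegenerateElliptic

end

/-! The proof is Nirenberg's method of difference quotients in the angle, followed by solving the
equation for the radial second derivative. Rotations preserve `Ω`, its measure, the weight and
`H¹_Γ`, so neither cut-offs nor commutators appear.

Write `u_h` for `u` rotated by `h`. Testing the weak equation with `u`, `u_h` and `u_{-h}` shows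
that the energy of `u_h - u` equals the integral of `g` against the second difference `2u - u_h -
u_{-h}`. This is an increment of an increment, so the integral is at most `‖g‖ ‖∂_θ u_h - ∂_θ u‖
|h|`: the mean value inequality gives this for smooth functions, and density carries it to `u`
(`HasWGrad.abs_integral_mul_second_diff_le`). Hence the increments of `∂_θ u` and of `r^(α/2) ∂_r u`
are at most `‖g‖ |h|` in `L²` (`IsWeakSolution.nrm_rot_sub_le`). Weak compactness
(`MemL2.exists_weak_dTheta`) turns these bounds into angular derivatives of norm at most `‖g‖`.

The equation then reads `r^(1+α/2) ∂_rr u = -r^(1-α/2) (g + ∂_θθ u) - α r^(α/2) ∂_r u`. The first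
weight is bounded because `α < 2`; the last term is controlled by the energy estimate, which rests
on the Hardy inequality `IsSmoothGamma.nrm_le`. -/

namespace DegenerateElliptic

open Filter Topology

/-! ### Smooth functions on the cylinder -/

/-- The lift of a function on the cylinder to its universal cover `ℝ × ℝ`. -/
noncomputable def lift (φ : Cyl → ℝ) (p : ℝ × ℝ) : ℝ := φ ((p.1 : AddCircle (2 * π)), p.2)

/-- Rotation of the cylinder by the angle `h`. -/
noncomputable def rot (h : ℝ) (z : Cyl) : Cyl := (z.1 + (h : AddCircle (2 * π)), z.2)

theorem isSmooth_iff {φ : Cyl → ℝ} : IsSmooth φ ↔ ContDiff ℝ ∞ (lift φ) := Iff.rfl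

theorem exists_lift (z : Cyl) : ∃ t : ℝ, z = ((t : AddCircle (2 * π)), z.2) := by
  obtain ⟨t, ht⟩ := QuotientAddGroup.mk_surjective z.1
  exact ⟨t, by ext1 <;> [exact ht.symm; rfl]⟩

theorem isOpenQuotientMap_cover :
    IsOpenQuotientMap fun p : ℝ × ℝ => (((p.1 : AddCircle (2 * π)), p.2) : Cyl) :=
  (QuotientAddGroup.isOpenQuotientMap_mk).prodMap IsOpenQuotientMap.id

theorem IsSmooth.continuous {φ : Cyl → ℝ} (hφ : IsSmooth φ) : Continuous φ :=
  isOpenQuotientMap_cover.isQuotientMap.continuous_iff.2 (ContDiff.continuous hφ)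

theorem IsSmooth.mul {φ ψ : Cyl → ℝ} (hφ : IsSmooth φ) (hψ : IsSmooth ψ) :
    IsSmooth fun z => φ z * ψ z :=
  ContDiff.mul (f := lift φ) (g := lift ψ) hφ hψ

theorem IsSmooth.sub {φ ψ : Cyl → ℝ} (hφ : IsSmooth φ) (hψ : IsSmooth ψ) :
    IsSmooth fun z => φ z - ψ z :=
  ContDiff.sub (f := lift φ) (g := lift ψ) hφ hψ

theorem isSmooth_radius : IsSmooth fun z => z.2 := contDiff_snd

theorem IsSmooth.rot {φ : Cyl → ℝ} (hφ : IsSmooth φ) (h : ℝ) :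
    IsSmooth fun z => φ (rot h z) := by
  have : ContDiff ℝ ∞ fun p : ℝ × ℝ => lift φ (p.1 + h, p.2) :=
    (isSmooth_iff.1 hφ).comp (by fun_prop)
  rw [isSmooth_iff]
  convert this using 2 with p
  simp [lift, DegenerateElliptic.rot]

theorem IsSmooth.differentiableAt_lift {φ : Cyl → ℝ} (hφ : IsSmooth φ) (p : ℝ × ℝ) :
    DifferentiableAt ℝ (lift φ) p :=
  (isSmooth_iff.1 hφ).differentiable (by simp) p

theorem IsSmooth.hasDerivAt_theta {φ : Cyl → ℝ} (hφ : IsSmooth φ) (p : ℝ × ℝ) :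
    HasDerivAt (fun t : ℝ => lift φ (p.1 + t, p.2)) (fderiv ℝ (lift φ) p (1, 0)) 0 := by
  have h1 : HasDerivAt (fun t : ℝ => (p.1 + t, p.2)) ((1 : ℝ), (0 : ℝ)) 0 :=
    ((hasDerivAt_id (0 : ℝ)).const_add p.1).prodMk (hasDerivAt_const _ _)
  have h2 : HasFDerivAt (lift φ) (fderiv ℝ (lift φ) p) (p.1 + (0 : ℝ), p.2) := by
    simpa using (hφ.differentiableAt_lift p).hasFDerivAt
  exact h2.comp_hasDerivAt 0 h1

theorem IsSmooth.hasDerivAt_radius {φ : Cyl → ℝ} (hφ : IsSmooth φ) (p : ℝ × ℝ) :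
    HasDerivAt (fun s : ℝ => lift φ (p.1, s)) (fderiv ℝ (lift φ) p (0, 1)) p.2 := by
  have h1 : HasDerivAt (fun s : ℝ => (p.1, s)) ((0 : ℝ), (1 : ℝ)) p.2 :=
    (hasDerivAt_const _ _).prodMk (hasDerivAt_id _)
  exact (hφ.differentiableAt_lift p).hasFDerivAt.comp_hasDerivAt p.2 h1

theorem lift_dTheta {φ : Cyl → ℝ} (hφ : IsSmooth φ) :
    lift (dTheta φ) = fun p => fderiv ℝ (lift φ) p (1, 0) := by
  ext p
  rw [← (hφ.hasDerivAt_theta p).deriv]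
  simp [lift, dTheta]

theorem lift_dR {φ : Cyl → ℝ} (hφ : IsSmooth φ) :
    lift (dR φ) = fun p => fderiv ℝ (lift φ) p (0, 1) := by
  ext p
  rw [← (hφ.hasDerivAt_radius p).deriv]
  rfl

theorem IsSmooth.dTheta {φ : Cyl → ℝ} (hφ : IsSmooth φ) : IsSmooth (dTheta φ) := by
  rw [isSmooth_iff, lift_dTheta hφ]
  exact (ContDiff.fderiv_right (isSmooth_iff.1 hφ) (by simp)).clm_apply contDiff_const

theorem IsSmooth.dR {φ : Cyl → ℝ} (hφ : IsSmooth φ) : IsSmooth (dR φ) := by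
  rw [isSmooth_iff, lift_dR hφ]
  exact (ContDiff.fderiv_right (isSmooth_iff.1 hφ) (by simp)).clm_apply contDiff_const

/-- The angular derivative at every point of an orbit of the rotation. -/
theorem IsSmooth.hasDerivAt_rot {φ : Cyl → ℝ} (hφ : IsSmooth φ) (z : Cyl) (t : ℝ) :
    HasDerivAt (fun s : ℝ => φ (DegenerateElliptic.rot s z))
      (DegenerateElliptic.dTheta φ (DegenerateElliptic.rot t z)) t := by
  obtain ⟨x, hx⟩ := exists_lift z
  have h := hφ.hasDerivAt_theta (x + t, z.2)
  rw [← congrFun (lift_dTheta hφ) (x + t, z.2)] at h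
  have h' := HasDerivAt.comp_sub_const t t (by simpa using h)
  rw [hx]
  have h1 : ∀ (ψ : Cyl → ℝ) (s : ℝ),
      ψ (DegenerateElliptic.rot s ((x : AddCircle (2 * π)), z.2)) = lift ψ (x + s, z.2) :=
    fun ψ s => by simp [lift, DegenerateElliptic.rot]
  simp only [h1]
  simpa only [add_assoc, add_sub_cancel] using h'

theorem IsSmooth.hasDerivAt_dR {φ : Cyl → ℝ} (hφ : IsSmooth φ) (z : Cyl) :
    HasDerivAt (fun s : ℝ => φ (z.1, s)) (DegenerateElliptic.dR φ z) z.2 := by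
  obtain ⟨x, hx⟩ := exists_lift z
  have h := hφ.hasDerivAt_radius (x, z.2)
  rw [← congrFun (lift_dR hφ) (x, z.2)] at h
  rw [hx]
  exact h

theorem IsSmooth.hasDerivAt_dTheta {φ : Cyl → ℝ} (hφ : IsSmooth φ) (z : Cyl) :
    HasDerivAt (fun t : ℝ => φ (z.1 + (t : AddCircle (2 * π)), z.2))
      (DegenerateElliptic.dTheta φ z) 0 := by
  simpa [DegenerateElliptic.rot] using hφ.hasDerivAt_rot z 0

theorem dTheta_mul {φ ψ : Cyl → ℝ} (hφ : IsSmooth φ) (hψ : IsSmooth ψ) (z : Cyl) :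
    dTheta (fun z => φ z * ψ z) z = dTheta φ z * ψ z + φ z * dTheta ψ z := by
  refine ((hφ.hasDerivAt_dTheta z).mul (hψ.hasDerivAt_dTheta z)).deriv.trans ?_
  simp

theorem dR_mul {φ ψ : Cyl → ℝ} (hφ : IsSmooth φ) (hψ : IsSmooth ψ) (z : Cyl) :
    dR (fun z => φ z * ψ z) z = dR φ z * ψ z + φ z * dR ψ z :=
  ((hφ.hasDerivAt_dR z).mul (hψ.hasDerivAt_dR z)).deriv

theorem dTheta_sub {φ ψ : Cyl → ℝ} (hφ : IsSmooth φ) (hψ : IsSmooth ψ) (z : Cyl) :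
    dTheta (fun z => φ z - ψ z) z = dTheta φ z - dTheta ψ z :=
  ((hφ.hasDerivAt_dTheta z).sub (hψ.hasDerivAt_dTheta z)).deriv

theorem dTheta_rot (φ : Cyl → ℝ) (h : ℝ) (z : Cyl) :
    dTheta (fun z => φ (rot h z)) z = dTheta φ (rot h z) := by
  simp only [dTheta, rot, add_right_comm]

theorem dR_rot (φ : Cyl → ℝ) (h : ℝ) (z : Cyl) :
    dR (fun z => φ (rot h z)) z = dR φ (rot h z) := rfl

/-- Symmetry of the second derivative of the lift. It is needed for the mixed weak derivative, where
the weak radial derivative is tested against `dTheta φ`. -/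
theorem dTheta_dR_comm {φ : Cyl → ℝ} (hφ : IsSmooth φ) : dTheta (dR φ) = dR (dTheta φ) := by
  have hd : ∀ v : ℝ × ℝ, ∀ p w, fderiv ℝ (fun p => fderiv ℝ (lift φ) p v) p w
      = fderiv ℝ (fderiv ℝ (lift φ)) p w v := by
    intro v p w
    have : DifferentiableAt ℝ (fderiv ℝ (lift φ)) p :=
      (ContDiff.fderiv_right (m := 1) (isSmooth_iff.1 hφ)
        (WithTop.coe_le_coe.2 (le_top : (1 + 1 : ℕ∞) ≤ ⊤))).differentiable (by simp) p
    rw [fderiv_clm_apply this (differentiableAt_const v)]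
    simp
  ext z
  obtain ⟨x, hx⟩ := exists_lift z
  rw [hx]
  change lift (dTheta (dR φ)) (x, z.2) = lift (dR (dTheta φ)) (x, z.2)
  rw [lift_dTheta hφ.dR, lift_dR hφ.dTheta, lift_dTheta hφ, lift_dR hφ]
  simp only [hd]
  refine ((isSmooth_iff.1 hφ).contDiffAt.isSymmSndFDerivAt ?_).eq _ _
  simp only [minSmoothness_of_isRCLikeNormedField]
  exact WithTop.coe_le_coe.2 (le_top : (2 : ℕ∞) ≤ ⊤)

/-! ### Test functions -/

theorem rot_continuous (h : ℝ) : Continuous (rot h) := by unfold rot; fun_prop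

theorem rot_rot (h k : ℝ) (z : Cyl) : rot h (rot k z) = rot (k + h) z := by
  simp [rot, add_assoc]

theorem rot_zero (z : Cyl) : rot 0 z = z := by simp [rot]

/-- Rotation by `h` as a homeomorphism. -/
noncomputable def rotHomeomorph (h : ℝ) : Cyl ≃ₜ Cyl where
  toFun := rot h
  invFun := rot (-h)
  left_inv z := by simp [rot_rot, rot_zero]
  right_inv z := by simp [rot_rot, rot_zero]
  continuous_toFun := rot_continuous h
  continuous_invFun := rot_continuous (-h)

theorem mem_Omega {z : Cyl} : z ∈ Omega ↔ 0 < z.2 ∧ z.2 < 1 := by simp [Omega]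

theorem isOpen_Omega : IsOpen Omega := isOpen_univ.prod isOpen_Ioo

theorem tsupport_dTheta_subset (φ : Cyl → ℝ) : tsupport (dTheta φ) ⊆ tsupport φ := by
  refine closure_minimal (fun z hz => ?_) (isClosed_tsupport φ)
  by_contra hzs
  refine hz ?_
  have h0 : ∀ᶠ y in 𝓝 z, φ y = 0 := notMem_tsupport_iff_eventuallyEq.1 hzs
  have hc : Tendsto (fun t : ℝ => rot t z) (𝓝 0) (𝓝 z) := by
    have : Continuous fun t : ℝ => rot t z := by
      unfold rot
      exact (continuous_const.add (AddCircle.continuous_mk' _)).prodMk continuous_const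
    simpa [rot_zero] using this.tendsto 0
  have h1 : (fun t : ℝ => φ (z.1 + (t : AddCircle (2 * π)), z.2)) =ᶠ[𝓝 0] fun _ => 0 :=
    hc.eventually h0
  simp [dTheta, h1.deriv_eq]

theorem tsupport_dR_subset (φ : Cyl → ℝ) : tsupport (dR φ) ⊆ tsupport φ := by
  refine closure_minimal (fun z hz => ?_) (isClosed_tsupport φ)
  by_contra hzs
  refine hz ?_
  have h0 : ∀ᶠ y in 𝓝 z, φ y = 0 := notMem_tsupport_iff_eventuallyEq.1 hzs
  have hc : Tendsto (fun s : ℝ => ((z.1, s) : Cyl)) (𝓝 z.2) (𝓝 z) :=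
    (continuous_const.prodMk continuous_id : Continuous fun s : ℝ => ((z.1, s) : Cyl)).tendsto z.2
  have h1 : (fun s : ℝ => φ (z.1, s)) =ᶠ[𝓝 z.2] fun _ => 0 := hc.eventually h0
  simp [dR, h1.deriv_eq]

theorem IsTest.of_tsupport_subset {φ ψ : Cyl → ℝ} (hφ : IsTest φ) (hψ : IsSmooth ψ)
    (h : tsupport ψ ⊆ tsupport φ) : IsTest ψ :=
  ⟨hψ, hφ.2.1.of_isClosed_subset (isClosed_tsupport ψ) h, h.trans hφ.2.2⟩

theorem IsTest.dTheta {φ : Cyl → ℝ} (hφ : IsTest φ) : IsTest (dTheta φ) :=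
  hφ.of_tsupport_subset hφ.1.dTheta (tsupport_dTheta_subset φ)

theorem IsTest.dR {φ : Cyl → ℝ} (hφ : IsTest φ) : IsTest (dR φ) :=
  hφ.of_tsupport_subset hφ.1.dR (tsupport_dR_subset φ)

theorem IsTest.rot {φ : Cyl → ℝ} (hφ : IsTest φ) (h : ℝ) :
    IsTest fun z => φ (DegenerateElliptic.rot h z) := by
  refine ⟨hφ.1.rot h, hφ.2.1.comp_homeomorph (rotHomeomorph h), ?_⟩
  have h1 : tsupport (fun z => φ (DegenerateElliptic.rot h z)) ⊆
      DegenerateElliptic.rot h ⁻¹' tsupport φ :=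
    tsupport_comp_subset_preimage φ (rot_continuous h)
  exact fun z hz => by simpa [Omega, DegenerateElliptic.rot] using hφ.2.2 (h1 hz)

theorem IsTest.eq_zero {φ : Cyl → ℝ} (hφ : IsTest φ) {z : Cyl} (hz : z ∉ Omega) : φ z = 0 :=
  image_eq_zero_of_notMem_tsupport fun h => hz (hφ.2.2 h)

/-- A test function stays one when multiplied by a radial weight that is smooth for `r > 0`. -/
theorem IsTest.radial_mul {φ : Cyl → ℝ} (hφ : IsTest φ) {χ : ℝ → ℝ}
    (hχ : ∀ r, 0 < r → ContDiffAt ℝ ∞ χ r) : IsTest fun z => χ z.2 * φ z := by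
  refine hφ.of_tsupport_subset (contDiff_iff_contDiffAt.2 fun p => ?_)
    (tsupport_mul_subset_right)
  -- The weight may be singular at `r ≤ 0`, but the support of `φ` lies in `Ω`, so there the product
  -- vanishes in a neighbourhood.
  by_cases hp : 0 < p.2
  · exact ((hχ p.2 hp).comp p contDiffAt_snd).mul (isSmooth_iff.1 hφ.1).contDiffAt
  · have h0 : ∀ᶠ y in 𝓝 ((((p.1 : ℝ) : AddCircle (2 * π)), p.2) : Cyl), φ y = 0 :=
      notMem_tsupport_iff_eventuallyEq.1 fun h => hp (mem_Omega.1 (hφ.2.2 h)).1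
    have h1 := (isOpenQuotientMap_cover.continuous.tendsto p).eventually h0
    refine contDiffAt_const (c := (0 : ℝ)) |>.congr_of_eventuallyEq ?_
    filter_upwards [h1] with y hy
    rw [hy, mul_zero]

theorem IsTest.isSmoothGamma {φ : Cyl → ℝ} (hφ : IsTest φ) : IsSmoothGamma φ := by
  refine ⟨hφ.1, ?_⟩
  rcases (tsupport φ).eq_empty_or_nonempty with he | hne
  · exact ⟨1, one_pos, fun z _ _ => image_eq_zero_of_notMem_tsupport (by simp [he])⟩
  -- The compact support attains a largest radius, which is less than 1; the gap up to 1 serves as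
  -- `δ`.
  · obtain ⟨z₀, hz₀, hmax⟩ := hφ.2.1.isCompact.exists_isMaxOn hne continuous_snd.continuousOn
    refine ⟨1 - z₀.2, sub_pos.2 (mem_Omega.1 (hφ.2.2 hz₀)).2, fun z hz _ => ?_⟩
    refine image_eq_zero_of_notMem_tsupport fun h => ?_
    have := hmax h
    simp only [mem_ofPred_eq] at this
    linarith

theorem IsSmoothGamma.rot {φ : Cyl → ℝ} (hφ : IsSmoothGamma φ) (h : ℝ) :
    IsSmoothGamma fun z => φ (DegenerateElliptic.rot h z) := by
  obtain ⟨hs, δ, hδ, h0⟩ := hφ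
  exact ⟨hs.rot h, δ, hδ, fun z h1 h2 => h0 _ h1 h2⟩

theorem IsSmoothGamma.eq_zero {φ : Cyl → ℝ} (hφ : IsSmoothGamma φ) (θ : AddCircle (2 * π)) :
    φ (θ, 1) = 0 := by
  obtain ⟨-, δ, hδ, h0⟩ := hφ
  exact h0 (θ, 1) (by simpa using hδ) le_rfl

end DegenerateElliptic

namespace DegenerateElliptic

open Filter Topology

/-! ### The measure on `Ω` and the norm of `L²(Ω)` -/

theorem dz_eq_prod :
    dz = (volume : Measure (AddCircle (2 * π))).prod (volume.restrict (Ioo (0 : ℝ) 1)) := by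
  rw [dz, Omega, Measure.volume_eq_prod, ← Measure.prod_restrict, Measure.restrict_univ]

instance isFiniteMeasure_dz : IsFiniteMeasure dz := by
  rw [dz_eq_prod]; infer_instance

theorem ae_mem_Omega : ∀ᵐ z ∂dz, z ∈ Omega := ae_restrict_mem isOpen_Omega.measurableSet

theorem integral_dz_congr {f g : Cyl → ℝ} (h : ∀ z ∈ Omega, f z = g z) :
    ∫ z, f z ∂dz = ∫ z, g z ∂dz :=
  integral_congr_ae (ae_mem_Omega.mono h)

theorem measurePreserving_rot (h : ℝ) : MeasurePreserving (rot h) dz dz := by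
  rw [dz_eq_prod]
  exact (measurePreserving_add_right volume (h : AddCircle (2 * π))).prod (.id _)

theorem integral_comp_rot (h : ℝ) (f : Cyl → ℝ) : ∫ z, f (rot h z) ∂dz = ∫ z, f z ∂dz :=
  (measurePreserving_rot h).integral_comp (rotHomeomorph h).measurableEmbedding f

theorem MemL2.rot {f : Cyl → ℝ} (hf : MemL2 f) (h : ℝ) :
    MemL2 fun z => f (DegenerateElliptic.rot h z) :=
  MemLp.comp_measurePreserving hf (measurePreserving_rot h)

/-- The norm of `L²(Ω)`. -/
noncomputable def nrm (f : Cyl → ℝ) : ℝ := lpNorm f 2 dz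

theorem nrm_nonneg (f : Cyl → ℝ) : 0 ≤ nrm f := lpNorm_nonneg

theorem MemL2.add {f g : Cyl → ℝ} (hf : MemL2 f) (hg : MemL2 g) : MemL2 fun z => f z + g z :=
  MemLp.add hf hg

theorem MemL2.sub {f g : Cyl → ℝ} (hf : MemL2 f) (hg : MemL2 g) : MemL2 fun z => f z - g z :=
  MemLp.sub hf hg

theorem MemL2.neg {f : Cyl → ℝ} (hf : MemL2 f) : MemL2 fun z => -f z :=
  MemLp.neg hf

theorem MemL2.const_mul {f : Cyl → ℝ} (hf : MemL2 f) (c : ℝ) : MemL2 fun z => c * f z :=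
  MemLp.const_mul hf c

theorem MemL2.integrable {f : Cyl → ℝ} (hf : MemL2 f) : Integrable f dz :=
  MemLp.integrable (by norm_num) hf

theorem MemL2.integrable_mul {f g : Cyl → ℝ} (hf : MemL2 f) (hg : MemL2 g) :
    Integrable (fun z => f z * g z) dz :=
  MemLp.integrable_mul hf hg

theorem MemL2.integrable_sq {f : Cyl → ℝ} (hf : MemL2 f) : Integrable (fun z => f z ^ 2) dz :=
  MemLp.integrable_sq hf

theorem MemL2.congr {f g : Cyl → ℝ} (hf : MemL2 f) (h : ∀ z ∈ Omega, f z = g z) : MemL2 g :=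
  MemLp.ae_eq (ae_mem_Omega.mono h) hf

theorem inner_toLp {f g : Cyl → ℝ} (hf : MemLp f 2 dz) (hg : MemLp g 2 dz) :
    inner ℝ (MemLp.toLp f hf) (MemLp.toLp g hg) = ∫ z, f z * g z ∂dz := by
  rw [L2.inner_def]
  refine integral_congr_ae ?_
  filter_upwards [MemLp.coeFn_toLp hf, MemLp.coeFn_toLp hg] with z h1 h2
  rw [h1, h2]
  simp [mul_comm]

theorem norm_toLp_eq_nrm {f : Cyl → ℝ} (hf : MemLp f 2 dz) : ‖MemLp.toLp f hf‖ = nrm f := by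
  rw [Lp.norm_toLp, nrm, toReal_eLpNorm hf.1]

theorem MemL2.nrm_sq {f : Cyl → ℝ} (hf : MemL2 f) : nrm f ^ 2 = ∫ z, f z ^ 2 ∂dz := by
  have hf' : MemLp f 2 dz := hf
  rw [← norm_toLp_eq_nrm hf', ← real_inner_self_eq_norm_sq, inner_toLp]
  simp only [sq]

theorem MemL2.nrm_mono {f g : Cyl → ℝ} (hf : MemL2 f) (hg : MemL2 g)
    (h : ∀ z ∈ Omega, |f z| ≤ |g z|) : nrm f ≤ nrm g := by
  refine (sq_le_sq₀ (nrm_nonneg _) (nrm_nonneg _)).1 ?_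
  rw [hf.nrm_sq, hg.nrm_sq]
  exact integral_mono_ae hf.integrable_sq hg.integrable_sq
    (ae_mem_Omega.mono fun z hz => sq_le_sq.2 (h z hz))

theorem MemL2.abs_integral_mul_le {f g : Cyl → ℝ} (hf : MemL2 f) (hg : MemL2 g) :
    |∫ z, f z * g z ∂dz| ≤ nrm f * nrm g := by
  rw [← inner_toLp hf hg, ← norm_toLp_eq_nrm hf, ← norm_toLp_eq_nrm hg]
  exact abs_real_inner_le_norm _ _

theorem MemL2.nrm_sub_le {f g : Cyl → ℝ} (hf : MemL2 f) :
    nrm (fun z => f z - g z) ≤ nrm f + nrm g :=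
  lpNorm_sub_le hf (by norm_num)

theorem MemL2.nrm_le_add_nrm_sub {f g : Cyl → ℝ} (hg : MemL2 g) :
    nrm f ≤ nrm g + nrm fun z => f z - g z := by
  have h := lpNorm_add_le (g := f - g) hg (by norm_num : (1 : ENNReal) ≤ 2)
  rwa [add_sub_cancel] at h

theorem nrm_sub_comm (f g : Cyl → ℝ) :
    nrm (fun z => f z - g z) = nrm fun z => g z - f z := lpNorm_sub_comm f g 2 dz

theorem nrm_rot {f : Cyl → ℝ} (hf : MemL2 f) (h : ℝ) : nrm (fun z => f (rot h z)) = nrm f := by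
  refine (sq_eq_sq₀ (nrm_nonneg _) (nrm_nonneg _)).1 ?_
  rw [hf.nrm_sq, (hf.rot h).nrm_sq]
  exact integral_comp_rot h fun z => f z ^ 2

theorem exists_bound_of_continuous {f : Cyl → ℝ} (hf : Continuous f) :
    ∃ C, ∀ z ∈ Omega, ‖f z‖ ≤ C := by
  obtain ⟨C, hC⟩ := (isCompact_univ.prod isCompact_Icc :
    IsCompact ((univ : Set (AddCircle (2 * π))) ×ˢ Icc (0 : ℝ) 1)).exists_bound_of_continuousOn
      hf.continuousOn
  exact ⟨C, fun z hz => hC z ⟨mem_univ _, Ioo_subset_Icc_self hz.2⟩⟩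

theorem memL2_of_continuous {f : Cyl → ℝ} (hf : Continuous f) : MemL2 f := by
  obtain ⟨C, hC⟩ := exists_bound_of_continuous hf
  exact MemLp.of_bound hf.aestronglyMeasurable C (ae_mem_Omega.mono hC)

theorem IsSmooth.memL2 {φ : Cyl → ℝ} (hφ : IsSmooth φ) : MemL2 φ :=
  memL2_of_continuous hφ.continuous

theorem IsSmooth.memL2_rpow_mul {φ : Cyl → ℝ} (hφ : IsSmooth φ) {s : ℝ} (hs : 0 ≤ s) :
    MemL2 fun z => z.2 ^ s * φ z :=
  memL2_of_continuous
    (((Real.continuous_rpow_const hs).comp continuous_snd).mul hφ.continuous)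

/-- Multiplication by a function of `r` that is bounded on `(0, 1)` preserves `L²(Ω)`. -/
theorem MemL2.rpow_mul {f : Cyl → ℝ} (hf : MemL2 f) {s : ℝ} (hs : 0 ≤ s) :
    MemL2 fun z => z.2 ^ s * f z := by
  have hm : Measurable fun z : Cyl => z.2 ^ s := measurable_snd.pow_const s
  refine MemLp.mono hf (hm.aestronglyMeasurable.mul hf.1) (ae_mem_Omega.mono fun z hz => ?_)
  have h := mem_Omega.1 hz
  rw [norm_mul]
  refine mul_le_of_le_one_left (norm_nonneg _) ?_
  rw [Real.norm_of_nonneg (Real.rpow_nonneg h.1.le _)]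
  exact Real.rpow_le_one h.1.le h.2.le hs

theorem MemL2.locallyIntegrableOn {f : Cyl → ℝ} (hf : MemL2 f) : LocallyIntegrableOn f Omega :=
  IntegrableOn.locallyIntegrableOn (μ := volume) hf.integrable

/-- A function whose product with a power of `r` is in `L²(Ω)` is locally integrable. -/
theorem locallyIntegrableOn_of_rpow_mul {f : Cyl → ℝ} {s : ℝ}
    (hf : MemL2 fun z => z.2 ^ s * f z) : LocallyIntegrableOn f Omega := by
  have hc : ContinuousOn (fun z : Cyl => z.2 ^ (-s)) Omega := fun z hz =>
    (continuousAt_snd.rpow_const (Or.inl (mem_Omega.1 hz).1.ne')).continuousWithinAt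
  have h := hf.locallyIntegrableOn.continuousOn_mul hc isOpen_Omega.isLocallyClosed
  refine (locallyIntegrableOn_iff isOpen_Omega.isLocallyClosed).2 fun K hK hKc => ?_
  refine (((locallyIntegrableOn_iff isOpen_Omega.isLocallyClosed).1 h) K hK hKc).congr_fun
    (fun z hz => ?_) hKc.measurableSet
  have h0 := (mem_Omega.1 (hK hz)).1
  simp only
  rw [← mul_assoc, ← Real.rpow_add h0]
  simp

/-! ### Integration by parts -/

/-- Differentiation under the integral, dominated because `∂_θ φ` is bounded on `Ω`. Angular
integration by parts, the increment bound and the limit of difference quotients all come from it. -/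
theorem IsSmooth.hasDerivAt_integral_rot {φ G : Cyl → ℝ} (hφ : IsSmooth φ) (hG : MemL2 G) (t : ℝ) :
    HasDerivAt (fun s => ∫ z, G z * φ (DegenerateElliptic.rot s z) ∂dz)
      (∫ z, G z * DegenerateElliptic.dTheta φ (DegenerateElliptic.rot t z) ∂dz) t := by
  obtain ⟨C, hC⟩ := exists_bound_of_continuous hφ.dTheta.continuous
  refine (hasDerivAt_integral_of_dominated_loc_of_deriv_le (𝕜 := ℝ) (s := univ)
    (F := fun s z => G z * φ (DegenerateElliptic.rot s z))
    (F' := fun s z => G z * DegenerateElliptic.dTheta φ (DegenerateElliptic.rot s z))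
    (bound := fun z => ‖G z‖ * C) univ_mem ?_ ?_ ?_ ?_ ?_ ?_).2
  · exact .of_forall fun s => (hG.integrable_mul (hφ.memL2.rot s)).1
  · exact hG.integrable_mul (hφ.memL2.rot t)
  · exact (hG.integrable_mul (hφ.dTheta.memL2.rot t)).1
  · refine ae_mem_Omega.mono fun z hz s _ => ?_
    rw [norm_mul]
    refine mul_le_mul_of_nonneg_left (hC _ ?_) (norm_nonneg _)
    simpa [Omega, DegenerateElliptic.rot] using hz
  · exact hG.integrable.norm.mul_const C
  · exact .of_forall fun z s _ => (hφ.hasDerivAt_rot z s).const_mul (G z)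

/-- Mean value inequality in the angle of rotation: by Cauchy–Schwarz and rotation invariance of the
norm, the derivative is bounded uniformly in the angle. -/
theorem IsSmooth.abs_integral_mul_rot_sub_le {φ G : Cyl → ℝ} (hφ : IsSmooth φ) (hG : MemL2 G)
    (h : ℝ) :
    |∫ z, G z * (φ (DegenerateElliptic.rot h z) - φ z) ∂dz| ≤
      nrm G * nrm (DegenerateElliptic.dTheta φ) * |h| := by
  have hd : ∀ t ∈ (univ : Set ℝ), HasDerivWithinAt _ _ univ t :=
    fun t _ => (hφ.hasDerivAt_integral_rot hG t).hasDerivWithinAt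
  have h1 := Convex.norm_image_sub_le_of_norm_hasDerivWithin_le hd
    (C := nrm G * nrm (DegenerateElliptic.dTheta φ))
    (fun t _ => ?_) convex_univ (mem_univ (0 : ℝ)) (mem_univ h)
  · simp only [rot_zero, sub_zero, Real.norm_eq_abs] at h1
    rw [← integral_sub (hG.integrable_mul (hφ.memL2.rot h)) (hG.integrable_mul hφ.memL2)] at h1
    simpa only [mul_sub] using h1
  · rw [Real.norm_eq_abs, ← nrm_rot hφ.dTheta.memL2 t]
    exact hG.abs_integral_mul_le (hφ.dTheta.memL2.rot t)

/-- The integral of a rotated function does not depend on the angle, so its derivative in the angle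
is zero. -/
theorem IsSmooth.integral_dTheta {φ : Cyl → ℝ} (hφ : IsSmooth φ) :
    ∫ z, DegenerateElliptic.dTheta φ z ∂dz = 0 := by
  have h := hφ.hasDerivAt_integral_rot (memL2_of_continuous (continuous_const (y := (1 : ℝ)))) 0
  simp only [one_mul, integral_comp_rot] at h
  exact h.unique (hasDerivAt_const _ _)

theorem IsSmooth.integral_dR {φ : Cyl → ℝ} (hφ : IsSmooth φ) (h0 : ∀ θ, φ (θ, 0) = 0)
    (h1 : ∀ θ, φ (θ, 1) = 0) : ∫ z, DegenerateElliptic.dR φ z ∂dz = 0 := by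
  have hi := hφ.dR.memL2.integrable
  rw [dz_eq_prod] at hi ⊢
  rw [integral_prod _ hi]
  refine (integral_congr_ae (.of_forall fun θ => ?_)).trans (integral_zero _ _)
  have hc : Continuous fun r : ℝ => DegenerateElliptic.dR φ (θ, r) :=
    hφ.dR.continuous.comp (by fun_prop)
  have h := intervalIntegral.integral_eq_sub_of_hasDerivAt (a := 0) (b := 1)
    (f := fun r => φ (θ, r)) (fun r _ => hφ.hasDerivAt_dR (θ, r)) (hc.intervalIntegrable 0 1)
  rw [h0, h1, sub_zero, intervalIntegral.integral_of_le zero_le_one,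
    integral_Ioc_eq_integral_Ioo] at h
  exact h

theorem IsTest.eq_zero_bot {φ : Cyl → ℝ} (hφ : IsTest φ) (θ : AddCircle (2 * π)) : φ (θ, 0) = 0 :=
  hφ.eq_zero fun h => (mem_Omega.1 h).1.false

theorem IsTest.eq_zero_top {φ : Cyl → ℝ} (hφ : IsTest φ) (θ : AddCircle (2 * π)) : φ (θ, 1) = 0 :=
  hφ.eq_zero fun h => (mem_Omega.1 h).2.false

theorem IsSmooth.hasWeakDeriv_dTheta {φ : Cyl → ℝ} (hφ : IsSmooth φ) :
    HasWeakDeriv 1 0 φ (DegenerateElliptic.dTheta φ) := by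
  refine ⟨hφ.memL2.locallyIntegrableOn, hφ.dTheta.memL2.locallyIntegrableOn, fun ψ hψ => ?_⟩
  have h := (hφ.mul hψ.1).integral_dTheta
  simp only [dTheta_mul hφ hψ.1] at h
  rw [integral_add (hφ.dTheta.memL2.integrable_mul hψ.1.memL2)
    (hφ.memL2.integrable_mul hψ.1.dTheta.memL2)] at h
  simp only [Function.iterate_one, Function.iterate_zero, id_eq, add_zero, pow_one]
  linarith

theorem IsSmooth.hasWeakDeriv_dR {φ : Cyl → ℝ} (hφ : IsSmooth φ) :
    HasWeakDeriv 0 1 φ (DegenerateElliptic.dR φ) := by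
  refine ⟨hφ.memL2.locallyIntegrableOn, hφ.dR.memL2.locallyIntegrableOn, fun ψ hψ => ?_⟩
  have h := (hφ.mul hψ.1).integral_dR (fun θ => by simp [hψ.eq_zero_bot])
    (fun θ => by simp [hψ.eq_zero_top])
  simp only [dR_mul hφ hψ.1] at h
  rw [integral_add (hφ.dR.memL2.integrable_mul hψ.1.memL2)
    (hφ.memL2.integrable_mul hψ.1.dR.memL2)] at h
  simp only [Function.iterate_one, Function.iterate_zero, id_eq, zero_add, pow_one]
  linarith

theorem IsSmooth.hasWGrad {φ : Cyl → ℝ} (hφ : IsSmooth φ) {α : ℝ} (hα : 0 ≤ α) :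
    HasWGrad α φ (DegenerateElliptic.dTheta φ) (DegenerateElliptic.dR φ) :=
  ⟨hφ.memL2, hφ.hasWeakDeriv_dTheta, hφ.hasWeakDeriv_dR, hφ.dTheta.memL2,
    hφ.dR.memL2_rpow_mul (by positivity)⟩

theorem IsSmoothGamma.memH1Gamma {φ : Cyl → ℝ} (hφ : IsSmoothGamma φ) {α : ℝ} (hα : 0 ≤ α) :
    MemH1Gamma α φ :=
  ⟨_, _, hφ.1.hasWGrad hα, fun ε hε => ⟨φ, hφ, by simpa using hε⟩⟩

/-- A Poincaré (Hardy) inequality for smooth functions vanishing on `Γ`. -/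
theorem IsSmoothGamma.nrm_le {φ : Cyl → ℝ} (hφ : IsSmoothGamma φ) {α : ℝ} (h0 : 0 ≤ α)
    (h2 : α ≤ 2) : nrm φ ≤ 2 * nrm fun z => z.2 ^ (α / 2) * dR φ z := by
  have hs := hφ.1
  have hr := isSmooth_radius
  have hp : IsSmooth fun z => z.2 * dR φ z := hr.mul hs.dR
  have hdr : ∀ z, dR (fun z => z.2) z = 1 := fun z => (hasDerivAt_id z.2).deriv
  -- Integrating `∂_r (r φ²)` leaves no boundary terms: the factor `r` kills the one at 0, and `φ`
  -- vanishes on `Γ`. Thus `‖φ‖² = -2 ∫ φ r ∂_r φ`.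
  have hint := (hr.mul (hs.mul hs)).integral_dR (fun θ => by simp) (fun θ => by simp [hφ.eq_zero])
  have e1 : ∀ z, dR (fun z => z.2 * (φ z * φ z)) z = φ z ^ 2 + 2 * (φ z * (z.2 * dR φ z)) := by
    intro z
    rw [dR_mul hr (hs.mul hs), dR_mul hs hs, hdr]
    ring
  simp only [e1] at hint
  rw [integral_add hs.memL2.integrable_sq ((hs.memL2.integrable_mul hp.memL2).const_mul 2),
    integral_const_mul, ← hs.memL2.nrm_sq] at hint
  have h3 := (abs_le.1 (hs.memL2.abs_integral_mul_le hp.memL2)).1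
  have h4 : nrm φ ≤ 2 * nrm fun z => z.2 * dR φ z := by
    by_contra! hlt
    nlinarith [nrm_nonneg φ, nrm_nonneg fun z => z.2 * dR φ z]
  refine h4.trans (mul_le_mul_of_nonneg_left ?_ zero_le_two)
  have hq : MemL2 fun z => z.2 ^ (α / 2) * dR φ z := hs.dR.memL2_rpow_mul (by positivity)
  refine hp.memL2.nrm_mono hq fun z hz => ?_
  have h := mem_Omega.1 hz
  -- Here `α ≤ 2` enters: the weight dominates `r²` on `(0, 1)`.
  have h5 : z.2 ≤ z.2 ^ (α / 2) := by
    simpa using Real.rpow_le_rpow_of_exponent_ge h.1 h.2.le (by linarith : α / 2 ≤ 1)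
  rw [abs_mul, abs_mul, abs_of_pos h.1, abs_of_pos (h.1.trans_le h5)]
  exact mul_le_mul_of_nonneg_right h5 (abs_nonneg _)

end DegenerateElliptic

namespace DegenerateElliptic

open Filter Topology

/-! ### Weak gradients and rotations -/

theorem integral_rot_mul (f g : Cyl → ℝ) (h : ℝ) :
    ∫ z, f (rot h z) * g z ∂dz = ∫ z, f z * g (rot (-h) z) ∂dz := by
  rw [← integral_comp_rot h fun z => f z * g (rot (-h) z)]
  simp [rot_rot, rot_zero]

theorem HasWGrad.rot {α : ℝ} {u p q : Cyl → ℝ} (hu : HasWGrad α u p q) (h : ℝ) :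
    HasWGrad α (fun z => u (rot h z)) (fun z => p (rot h z)) (fun z => q (rot h z)) := by
  have hq : MemL2 fun z => z.2 ^ (α / 2) * q (DegenerateElliptic.rot h z) := hu.memL2_r.rot h
  refine ⟨hu.memL2.rot h,
    ⟨(hu.memL2.rot h).locallyIntegrableOn, (hu.memL2_theta.rot h).locallyIntegrableOn,
      fun φ hφ => ?_⟩,
    ⟨(hu.memL2.rot h).locallyIntegrableOn, locallyIntegrableOn_of_rpow_mul hq, fun φ hφ => ?_⟩,
    hu.memL2_theta.rot h, hq⟩
  · have e := hu.weak_theta.2.2 _ (hφ.rot (-h))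
    rw [integral_rot_mul, integral_rot_mul p φ, ← e]
    simp [dTheta_rot]
  · have e := hu.weak_r.2.2 _ (hφ.rot (-h))
    rw [integral_rot_mul, integral_rot_mul q φ, ← e]
    simp [dR_rot]

theorem MemH1Gamma.rot {α : ℝ} {u : Cyl → ℝ} (hu : MemH1Gamma α u) (h : ℝ) :
    MemH1Gamma α fun z => u (rot h z) := by
  obtain ⟨p, q, hpq, happ⟩ := hu
  refine ⟨_, _, hpq.rot h, fun ε hε => ?_⟩
  obtain ⟨φ, hφ, hlt⟩ := happ ε hε
  refine ⟨_, hφ.rot h, ?_⟩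
  rw [← integral_comp_rot h] at hlt
  simp only [dTheta_rot, dR_rot]
  exact hlt

/-- The energy form in terms of the rescaled radial derivatives. -/
theorem HasWGrad.integral_form {α : ℝ} {u p q v p' q' : Cyl → ℝ} (hu : HasWGrad α u p q)
    (hv : HasWGrad α v p' q') :
    ∫ z, (p z * p' z + z.2 ^ α * q z * q' z) ∂dz =
      (∫ z, p z * p' z ∂dz) + ∫ z, (z.2 ^ (α / 2) * q z) * (z.2 ^ (α / 2) * q' z) ∂dz := by
  rw [← integral_add (hu.memL2_theta.integrable_mul hv.memL2_theta)
    (hu.memL2_r.integrable_mul hv.memL2_r)]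
  refine integral_dz_congr fun z hz => ?_
  have h : z.2 ^ α = z.2 ^ (α / 2) * z.2 ^ (α / 2) := by
    rw [← Real.rpow_add (mem_Omega.1 hz).1, add_halves]
  rw [h]
  ring

/-- The approximation hypothesis is tied to the particular pair `p, q`. Carrying it along with that
pair avoids any appeal to uniqueness of weak gradients. -/
theorem HasWGrad.exists_smooth_approx {α : ℝ} {u p q : Cyl → ℝ} (hα : 0 ≤ α)
    (hu : HasWGrad α u p q)
    (happ : ∀ ε > (0 : ℝ), ∃ φ : Cyl → ℝ, IsSmoothGamma φ ∧
      ∫ z, ((p z - dTheta φ z) ^ 2 + z.2 ^ α * (q z - dR φ z) ^ 2 + (u z - φ z) ^ 2) ∂dz < ε)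
    {ε : ℝ} (hε : 0 < ε) :
    ∃ φ : Cyl → ℝ, IsSmoothGamma φ ∧ nrm (fun z => u z - φ z) ≤ ε ∧
      nrm (fun z => p z - dTheta φ z) ≤ ε ∧
      nrm (fun z => z.2 ^ (α / 2) * q z - z.2 ^ (α / 2) * dR φ z) ≤ ε := by
  obtain ⟨φ, hφ, hlt⟩ := happ (ε ^ 2) (by positivity)
  refine ⟨φ, hφ, ?_⟩
  have h1 := hu.memL2.sub hφ.1.memL2
  have h2 := hu.memL2_theta.sub hφ.1.dTheta.memL2
  have h3 := hu.memL2_r.sub (hφ.1.dR.memL2_rpow_mul (by positivity : 0 ≤ α / 2))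
  have e : ∫ z, ((p z - dTheta φ z) ^ 2 + z.2 ^ α * (q z - dR φ z) ^ 2 + (u z - φ z) ^ 2) ∂dz =
      nrm (fun z => p z - dTheta φ z) ^ 2
        + nrm (fun z => z.2 ^ (α / 2) * q z - z.2 ^ (α / 2) * dR φ z) ^ 2
        + nrm (fun z => u z - φ z) ^ 2 := by
    have i : Integrable (fun z => (p z - dTheta φ z) ^ 2
        + (z.2 ^ (α / 2) * q z - z.2 ^ (α / 2) * dR φ z) ^ 2) dz :=
      h2.integrable_sq.add h3.integrable_sq
    rw [h1.nrm_sq, h2.nrm_sq, h3.nrm_sq, ← integral_add h2.integrable_sq h3.integrable_sq,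
      ← integral_add i h1.integrable_sq]
    refine integral_dz_congr fun z hz => ?_
    have h : z.2 ^ α = z.2 ^ (α / 2) * z.2 ^ (α / 2) := by
      rw [← Real.rpow_add (mem_Omega.1 hz).1, add_halves]
    rw [h]
    ring
  rw [e] at hlt
  refine ⟨?_, ?_, ?_⟩ <;> refine abs_le_of_sq_le_sq' ?_ hε.le |>.2 <;>
    nlinarith [sq_nonneg (nrm fun z => p z - dTheta φ z), sq_nonneg (nrm fun z => u z - φ z),
      sq_nonneg (nrm fun z => z.2 ^ (α / 2) * q z - z.2 ^ (α / 2) * dR φ z)]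

/-- The Poincaré inequality on `H¹_Γ(Ω; w)`. -/
theorem HasWGrad.nrm_le {α : ℝ} {u p q : Cyl → ℝ} (h0 : 0 ≤ α) (h2 : α ≤ 2)
    (hu : HasWGrad α u p q)
    (happ : ∀ ε > (0 : ℝ), ∃ φ : Cyl → ℝ, IsSmoothGamma φ ∧
      ∫ z, ((p z - dTheta φ z) ^ 2 + z.2 ^ α * (q z - dR φ z) ^ 2 + (u z - φ z) ^ 2) ∂dz < ε) :
    nrm u ≤ 2 * nrm fun z => z.2 ^ (α / 2) * q z := by
  refine le_of_forall_pos_le_add fun ε hε => ?_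
  obtain ⟨φ, hφ, hu', -, hq'⟩ := hu.exists_smooth_approx h0 happ (by positivity : 0 < ε / 3)
  have h3 := hφ.nrm_le h0 h2
  have h4 := hφ.1.memL2.nrm_le_add_nrm_sub (f := u)
  have h5 := hu.memL2_r.nrm_le_add_nrm_sub (f := fun z => z.2 ^ (α / 2) * dR φ z)
  rw [nrm_sub_comm] at h5
  linarith

/-! ### Angular increments and second differences -/

theorem MemL2.nrm_rot_sub_sq {f : Cyl → ℝ} (hf : MemL2 f) (h : ℝ) :
    nrm (fun z => f (DegenerateElliptic.rot h z) - f z) ^ 2 =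
      2 * (∫ z, f z * f z ∂dz) - (∫ z, f z * f (DegenerateElliptic.rot h z) ∂dz)
        - ∫ z, f z * f (DegenerateElliptic.rot (-h) z) ∂dz := by
  have hr := hf.rot h
  have e1 : ∫ z, f z * f (DegenerateElliptic.rot h z) ∂dz =
      ∫ z, f z * f (DegenerateElliptic.rot (-h) z) ∂dz := by
    rw [← integral_rot_mul]
    simp only [mul_comm]
  have e2 : ∫ z, f (DegenerateElliptic.rot h z) * f (DegenerateElliptic.rot h z) ∂dz =
      ∫ z, f z * f z ∂dz := integral_comp_rot h fun z => f z * f z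
  have e3 : ∀ z, (f (DegenerateElliptic.rot h z) - f z) ^ 2 =
      f (DegenerateElliptic.rot h z) * f (DegenerateElliptic.rot h z)
        - 2 * (f z * f (DegenerateElliptic.rot h z)) + f z * f z := fun z => by ring
  rw [(hr.sub hf).nrm_sq]
  simp only [e3]
  have i : Integrable (fun z => f (DegenerateElliptic.rot h z) * f (DegenerateElliptic.rot h z)
      - 2 * (f z * f (DegenerateElliptic.rot h z))) dz :=
    (hr.integrable_mul hr).sub ((hf.integrable_mul hr).const_mul 2)
  rw [integral_add i (hf.integrable_mul hf), integral_sub (hr.integrable_mul hr)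
    ((hf.integrable_mul hr).const_mul 2), integral_const_mul, e2]
  linarith

/-- The integral of `g` against a second difference, by pieces. -/
theorem MemL2.integral_mul_second_diff {g f : Cyl → ℝ} (hg : MemL2 g) (hf : MemL2 f) (h : ℝ) :
    ∫ z, g z * ((f z - f (DegenerateElliptic.rot h z))
        - (f (DegenerateElliptic.rot (-h) z) - f z)) ∂dz =
      2 * (∫ z, g z * f z ∂dz) - (∫ z, g z * f (DegenerateElliptic.rot h z) ∂dz)
        - ∫ z, g z * f (DegenerateElliptic.rot (-h) z) ∂dz := by
  have e : ∀ z, g z * ((f z - f (DegenerateElliptic.rot h z))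
        - (f (DegenerateElliptic.rot (-h) z) - f z)) =
      2 * (g z * f z) - g z * f (DegenerateElliptic.rot h z)
        - g z * f (DegenerateElliptic.rot (-h) z) := fun z => by ring
  simp only [e]
  have i : Integrable (fun z => 2 * (g z * f z) - g z * f (DegenerateElliptic.rot h z)) dz :=
    ((hg.integrable_mul hf).const_mul 2).sub (hg.integrable_mul (hf.rot h))
  rw [integral_sub i (hg.integrable_mul (hf.rot (-h))), integral_sub ((hg.integrable_mul hf).const_mul 2)
    (hg.integrable_mul (hf.rot h)), integral_const_mul]

/-- The second difference is the increment by `-h` of the increment of `φ` by `h`, so the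
first-order bound applies to the latter. -/
theorem IsSmooth.abs_integral_mul_second_diff_le {g φ : Cyl → ℝ} (hφ : IsSmooth φ) (hg : MemL2 g)
    (h : ℝ) :
    |∫ z, g z * ((φ z - φ (DegenerateElliptic.rot h z))
        - (φ (DegenerateElliptic.rot (-h) z) - φ z)) ∂dz| ≤
      nrm g * nrm (fun z => DegenerateElliptic.dTheta φ (DegenerateElliptic.rot h z)
        - DegenerateElliptic.dTheta φ z) * |h| := by
  have hw := (hφ.rot h).sub hφ
  have e := hw.abs_integral_mul_rot_sub_le hg (-h)
  have e1 : DegenerateElliptic.dTheta (fun z => φ (DegenerateElliptic.rot h z) - φ z) =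
      fun z => DegenerateElliptic.dTheta φ (DegenerateElliptic.rot h z)
        - DegenerateElliptic.dTheta φ z := by
    ext z
    rw [dTheta_sub (hφ.rot h) hφ, dTheta_rot]
  rw [e1, abs_neg] at e
  simp only [rot_rot, neg_add_cancel, rot_zero] at e
  convert e using 5
  ring

theorem HasWGrad.abs_integral_mul_second_diff_le {α : ℝ} {g u p q : Cyl → ℝ} (hα : 0 ≤ α)
    (hg : MemL2 g) (hu : HasWGrad α u p q)
    (happ : ∀ ε > (0 : ℝ), ∃ φ : Cyl → ℝ, IsSmoothGamma φ ∧
      ∫ z, ((p z - dTheta φ z) ^ 2 + z.2 ^ α * (q z - dR φ z) ^ 2 + (u z - φ z) ^ 2) ∂dz < ε)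
    (h : ℝ) :
    |∫ z, g z * ((u z - u (DegenerateElliptic.rot h z))
        - (u (DegenerateElliptic.rot (-h) z) - u z)) ∂dz| ≤
      nrm g * nrm (fun z => p (DegenerateElliptic.rot h z) - p z) * |h| := by
  have hg0 := nrm_nonneg g
  refine le_of_forall_pos_le_add fun ε hε => ?_
  -- Replacing `u` by `φ` costs `4δ` in the second difference and `2δ` in the increment of the
  -- angular derivative.
  obtain ⟨δ, hδ, hδε⟩ : ∃ δ > 0, nrm g * (4 + 2 * |h|) * δ ≤ ε := by
    refine ⟨ε / (nrm g * (4 + 2 * |h|) + 1), by positivity, ?_⟩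
    rw [← mul_div_assoc, div_le_iff₀ (by positivity)]
    nlinarith
  obtain ⟨φ, hφ, hu', hp', -⟩ := hu.exists_smooth_approx hα happ hδ
  have hφ2 := hφ.1.memL2
  have hd2 := hφ.1.dTheta.memL2
  have he := hu.memL2.sub hφ2
  have hep := hu.memL2_theta.sub hd2
  have h1 := hφ.1.abs_integral_mul_second_diff_le hg h
  have h2 : |∫ z, g z * (((u z - φ z) - (u (DegenerateElliptic.rot h z)
      - φ (DegenerateElliptic.rot h z))) - ((u (DegenerateElliptic.rot (-h) z)
        - φ (DegenerateElliptic.rot (-h) z)) - (u z - φ z))) ∂dz| ≤ nrm g * (4 * δ) := by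
    refine (hg.abs_integral_mul_le ((he.sub (he.rot h)).sub ((he.rot (-h)).sub he))).trans
      (mul_le_mul_of_nonneg_left ?_ hg0)
    have a1 := (he.sub (he.rot h)).nrm_sub_le
      (g := fun z => (u (DegenerateElliptic.rot (-h) z) - φ (DegenerateElliptic.rot (-h) z))
        - (u z - φ z))
    have a2 := he.nrm_sub_le
      (g := fun z => u (DegenerateElliptic.rot h z) - φ (DegenerateElliptic.rot h z))
    have a3 := (he.rot (-h)).nrm_sub_le (g := fun z => u z - φ z)
    rw [nrm_rot he h] at a2
    rw [nrm_rot he (-h)] at a3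
    linarith
  have h3 : nrm (fun z => dTheta φ (DegenerateElliptic.rot h z) - dTheta φ z) ≤
      nrm (fun z => p (DegenerateElliptic.rot h z) - p z) + 2 * δ := by
    have b1 := ((hu.memL2_theta.rot h).sub hu.memL2_theta).nrm_le_add_nrm_sub
      (f := fun z => dTheta φ (DegenerateElliptic.rot h z) - dTheta φ z)
    have b2 := hep.nrm_sub_le
      (g := fun z => p (DegenerateElliptic.rot h z) - dTheta φ (DegenerateElliptic.rot h z))
    rw [nrm_rot hep h] at b2
    have b3 : (fun z => dTheta φ (DegenerateElliptic.rot h z) - dTheta φ z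
        - (p (DegenerateElliptic.rot h z) - p z)) = fun z => (p z - dTheta φ z)
          - (p (DegenerateElliptic.rot h z) - dTheta φ (DegenerateElliptic.rot h z)) := by
      ext z; ring
    rw [b3] at b1
    linarith
  have h4 : ∫ z, g z * ((u z - u (DegenerateElliptic.rot h z))
        - (u (DegenerateElliptic.rot (-h) z) - u z)) ∂dz =
      (∫ z, g z * ((φ z - φ (DegenerateElliptic.rot h z))
        - (φ (DegenerateElliptic.rot (-h) z) - φ z)) ∂dz)
      + ∫ z, g z * (((u z - φ z) - (u (DegenerateElliptic.rot h z)
      - φ (DegenerateElliptic.rot h z))) - ((u (DegenerateElliptic.rot (-h) z)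
        - φ (DegenerateElliptic.rot (-h) z)) - (u z - φ z))) ∂dz := by
    rw [← integral_add (hg.integrable_mul ((hφ2.sub (hφ2.rot h)).sub ((hφ2.rot (-h)).sub hφ2)))
      (hg.integrable_mul ((he.sub (he.rot h)).sub ((he.rot (-h)).sub he)))]
    congr 1
    ext z
    ring
  rw [h4]
  refine (abs_add_le _ _).trans ((add_le_add h1 h2).trans ?_)
  have h5 := mul_le_mul_of_nonneg_right (mul_le_mul_of_nonneg_left h3 hg0) (abs_nonneg h)
  linarith

/-! ### Weak limits of difference quotients -/

/-- A bounded family in a Hilbert space has a weak cluster point. -/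
theorem exists_weak_clusterPt {H ι : Type*} [NormedAddCommGroup H] [InnerProductSpace ℝ H]
    [CompleteSpace H] (l : Filter ι) [l.NeBot] (x : ι → H) {C : ℝ} (hx : ∀ i, ‖x i‖ ≤ C) :
    ∃ a : H, ‖a‖ ≤ C ∧ ∀ v L, Tendsto (fun i => inner ℝ (x i) v) l (𝓝 L) → inner ℝ a v = L := by
  -- Riesz representation and Banach–Alaoglu. An ultrafilter finer than `l` replaces a subsequence
  -- and keeps every limit that exists along `l`.
  let y : ι → WeakDual ℝ H := fun i => StrongDual.toWeakDual (InnerProductSpace.toDual ℝ H (x i))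
  have hK := WeakDual.isCompact_closedBall (0 : StrongDual ℝ H) C
  have hy : ∀ i, y i ∈ WeakDual.toStrongDual ⁻¹' Metric.closedBall (0 : StrongDual ℝ H) C := by
    intro i
    simpa [y] using hx i
  have hle : ((Ultrafilter.of l).map y : Filter (WeakDual ℝ H)) ≤
      𝓟 (WeakDual.toStrongDual ⁻¹' Metric.closedBall (0 : StrongDual ℝ H) C) :=
    le_principal_iff.2 (Filter.Eventually.of_forall hy : ∀ᶠ i in (Ultrafilter.of l : Filter ι), _)
  obtain ⟨b, hb, hlim⟩ := hK.ultrafilter_le_nhds _ hle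
  refine ⟨(InnerProductSpace.toDual ℝ H).symm (WeakDual.toStrongDual b), ?_, fun v L hL => ?_⟩
  · simpa using hb
  · rw [InnerProductSpace.toDual_symm_apply]
    have h1 : Tendsto (fun i => y i v) (Ultrafilter.of l : Filter ι) (𝓝 (b v)) :=
      ((WeakDual.eval_continuous v).tendsto b).comp hlim
    exact tendsto_nhds_unique h1 (hL.mono_left (Ultrafilter.of_le l))

/-- Nirenberg's criterion: bounded difference quotients give a weak derivative. -/
theorem MemL2.exists_weak_dTheta {f : Cyl → ℝ} (hf : MemL2 f) {K : ℝ} (hK : 0 ≤ K)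
    (hd : ∀ h, nrm (fun z => f (DegenerateElliptic.rot h z) - f z) ≤ K * |h|) :
    ∃ a, MemL2 a ∧ nrm a ≤ K ∧
      ∀ φ, IsSmooth φ → ∫ z, f z * dTheta φ z ∂dz = -∫ z, a z * φ z ∂dz := by
  -- Rotating `f` by `-t` moves onto `φ` as a rotation by `t`, giving a forward quotient of `φ`. The
  -- weak cluster point is therefore minus the derivative sought.
  have hm : ∀ t : ℝ, MemLp (fun z => t⁻¹ * (f (DegenerateElliptic.rot (-t) z) - f z)) 2 dz :=
    fun t => ((hf.rot (-t)).sub hf).const_mul t⁻¹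
  have hb : ∀ t : ℝ, ‖(hm t).toLp‖ ≤ K := by
    intro t
    rw [norm_toLp_eq_nrm]
    refine (sq_le_sq₀ (nrm_nonneg _) hK).1 ?_
    rw [MemL2.nrm_sq (hm t)]
    simp only [mul_pow]
    rw [integral_const_mul, ← ((hf.rot (-t)).sub hf).nrm_sq, ← mul_pow, sq_le_sq, abs_mul,
      abs_of_nonneg (nrm_nonneg _), abs_of_nonneg hK]
    -- At `t = 0` the convention `0⁻¹ = 0` makes the quotient zero, so the bound holds for every
    -- `t`.
    rcases eq_or_ne t 0 with rfl | ht
    · simpa using hK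
    · have h1 := hd (-t)
      rw [abs_neg] at h1
      rw [abs_inv, inv_mul_le_iff₀ (abs_pos.2 ht), mul_comm |t|]
      exact h1
  obtain ⟨a, ha, hlim⟩ := exists_weak_clusterPt (𝓝[≠] (0 : ℝ)) _ hb
  have ha2 : MemLp a 2 dz := Lp.memLp a
  refine ⟨fun z => -a z, MemL2.neg ha2, ?_, fun φ hφ => ?_⟩
  · have h1 : nrm (fun z => -a z) = nrm a := lpNorm_neg a 2 dz
    rwa [h1, ← norm_toLp_eq_nrm ha2, Lp.toLp_coeFn]
  · have hφ2 : MemLp φ 2 dz := hφ.memL2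
    have h1 := hlim hφ2.toLp (∫ z, f z * dTheta φ z ∂dz) ?_
    · simp only [neg_mul, integral_neg, neg_neg]
      rw [← h1, ← inner_toLp ha2 hφ2, Lp.toLp_coeFn]
    · have h2 := (hφ.hasDerivAt_integral_rot hf 0).tendsto_slope_zero
      simp only [rot_zero, zero_add, smul_eq_mul] at h2
      refine h2.congr fun t => ?_
      have h3 : ∀ z, t⁻¹ * (f (DegenerateElliptic.rot (-t) z) - f z) * φ z =
          t⁻¹ * (f (DegenerateElliptic.rot (-t) z) * φ z - f z * φ z) := fun z => by ring
      rw [inner_toLp (hm t) hφ2]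
      simp only [h3]
      rw [integral_const_mul, integral_sub ((hf.rot (-t)).integrable_mul hφ.memL2)
        (hf.integrable_mul hφ.memL2), integral_rot_mul, neg_neg]

end DegenerateElliptic

namespace DegenerateElliptic

/-! ### Regularity of weak solutions -/

theorem MemL2.nrm_rpow_mul_le {f : Cyl → ℝ} (hf : MemL2 f) {s : ℝ} (hs : 0 ≤ s) :
    nrm (fun z => z.2 ^ s * f z) ≤ nrm f := by
  refine (hf.rpow_mul hs).nrm_mono hf fun z hz => ?_
  have h := mem_Omega.1 hz
  rw [abs_mul, abs_of_pos (Real.rpow_pos_of_pos h.1 s)]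
  exact mul_le_of_le_one_left (abs_nonneg _) (Real.rpow_le_one h.1.le h.2.le hs)

theorem nrm_const_mul {f : Cyl → ℝ} (hf : MemL2 f) (c : ℝ) :
    nrm (fun z => c * f z) = |c| * nrm f := by
  refine (sq_eq_sq₀ (nrm_nonneg _) (mul_nonneg (abs_nonneg c) (nrm_nonneg f))).1 ?_
  rw [(hf.const_mul c).nrm_sq, mul_pow, sq_abs, hf.nrm_sq, ← integral_const_mul]
  simp only [mul_pow]

theorem contDiffAt_rpow (s : ℝ) : ∀ r : ℝ, 0 < r → ContDiffAt ℝ ∞ (fun r => r ^ s) r :=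
  fun _ hr => Real.contDiffAt_rpow_const_of_ne hr.ne'

theorem dTheta_radial_mul (χ : ℝ → ℝ) (φ : Cyl → ℝ) (z : Cyl) :
    dTheta (fun z => χ z.2 * φ z) z = χ z.2 * dTheta φ z := by
  simp only [dTheta]
  exact deriv_const_mul_field _

theorem IsSmooth.dR_rpow_mul {φ : Cyl → ℝ} (hφ : IsSmooth φ) (s : ℝ) {z : Cyl} (hz : z ∈ Omega) :
    DegenerateElliptic.dR (fun z => z.2 ^ s * φ z) z =
      s * z.2 ^ (s - 1) * φ z + z.2 ^ s * DegenerateElliptic.dR φ z :=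
  ((Real.hasDerivAt_rpow_const (Or.inl (mem_Omega.1 hz).1.ne')).mul (hφ.hasDerivAt_dR z)).deriv

theorem MemL2.integrable_mul_test {q φ : Cyl → ℝ} {s : ℝ} (hq : MemL2 fun z => z.2 ^ s * q z)
    (hφ : IsTest φ) : Integrable (fun z => q z * φ z) dz := by
  have h := hq.integrable_mul (hφ.radial_mul (contDiffAt_rpow (-s))).1.memL2
  refine h.congr (ae_mem_Omega.mono fun z hz => ?_)
  have e : z.2 ^ s * z.2 ^ (-s) = 1 := by rw [← Real.rpow_add (mem_Omega.1 hz).1]; simp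
  linear_combination q z * φ z * e

section WeakSolution

variable {α : ℝ} {g u p q : Cyl → ℝ}

theorem IsWeakSolution.eq_inner (hw : IsWeakSolution α g u) (hu : HasWGrad α u p q)
    {v p' q' : Cyl → ℝ} (hv : MemH1Gamma α v) (hv' : HasWGrad α v p' q') :
    (∫ z, p z * p' z ∂dz) + ∫ z, (z.2 ^ (α / 2) * q z) * (z.2 ^ (α / 2) * q' z) ∂dz =
      ∫ z, g z * v z ∂dz := by
  rw [← hu.integral_form hv', hw.weak_eq p q hu v p' q' hv hv']

/-- Test with `u` itself, then bound `‖u‖` by the Poincaré inequality and cancel one factor of the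
radial norm. -/
theorem IsWeakSolution.nrm_r_le (h0 : 0 ≤ α) (h2 : α ≤ 2) (hg : MemL2 g)
    (hw : IsWeakSolution α g u) (hu : HasWGrad α u p q)
    (happ : ∀ ε > (0 : ℝ), ∃ φ : Cyl → ℝ, IsSmoothGamma φ ∧
      ∫ z, ((p z - dTheta φ z) ^ 2 + z.2 ^ α * (q z - dR φ z) ^ 2 + (u z - φ z) ^ 2) ∂dz < ε) :
    nrm (fun z => z.2 ^ (α / 2) * q z) ≤ 2 * nrm g := by
  have e := hw.eq_inner hu hw.memH1Gamma hu
  simp only [← sq] at e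
  rw [← hu.memL2_theta.nrm_sq, ← hu.memL2_r.nrm_sq] at e
  have h1 := (abs_le.1 (hg.abs_integral_mul_le hu.memL2)).2
  have h3 := mul_le_mul_of_nonneg_left (hu.nrm_le h0 h2 happ) (nrm_nonneg g)
  by_contra! hlt
  nlinarith [nrm_nonneg g, nrm_nonneg fun z => z.2 ^ (α / 2) * q z, sq_nonneg (nrm p)]

/-- The energy of the difference quotients of a weak solution. -/
theorem IsWeakSolution.nrm_rot_sub_le (h0 : 0 ≤ α) (hg : MemL2 g)
    (hw : IsWeakSolution α g u) (hu : HasWGrad α u p q)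
    (happ : ∀ ε > (0 : ℝ), ∃ φ : Cyl → ℝ, IsSmoothGamma φ ∧
      ∫ z, ((p z - dTheta φ z) ^ 2 + z.2 ^ α * (q z - dR φ z) ^ 2 + (u z - φ z) ^ 2) ∂dz < ε)
    (h : ℝ) :
    nrm (fun z => p (rot h z) - p z) ≤ nrm g * |h| ∧
      nrm (fun z => (rot h z).2 ^ (α / 2) * q (rot h z) - z.2 ^ (α / 2) * q z) ≤ nrm g * |h| := by
  have e0 := hw.eq_inner hu hw.memH1Gamma hu
  have e1 := hw.eq_inner hu (hw.memH1Gamma.rot h) (hu.rot h)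
  have e2 := hw.eq_inner hu (hw.memH1Gamma.rot (-h)) (hu.rot (-h))
  have hp := hu.memL2_theta.nrm_rot_sub_sq h
  have hq := hu.memL2_r.nrm_rot_sub_sq h
  have hs := hg.integral_mul_second_diff hu.memL2 h
  have hle := (le_abs_self _).trans (hu.abs_integral_mul_second_diff_le h0 hg happ h)
  -- Twice the equation tested with `u`, minus those tested with its rotations by `h` and `-h`.
  have e : nrm (fun z => p (rot h z) - p z) ^ 2
      + nrm (fun z => (rot h z).2 ^ (α / 2) * q (rot h z) - z.2 ^ (α / 2) * q z) ^ 2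
      = ∫ z, g z * ((u z - u (rot h z)) - (u (rot (-h) z) - u z)) ∂dz := by
    rw [hp, hq, hs, ← e0, ← e1, ← e2]
    simp only [show ∀ (k : ℝ) (z : Cyl), (rot k z).2 = z.2 from fun _ _ => rfl]
    ring
  rw [← e] at hle
  set P := nrm (fun z => p (rot h z) - p z)
  set Q := nrm (fun z => (rot h z).2 ^ (α / 2) * q (rot h z) - z.2 ^ (α / 2) * q z)
  have hP0 : 0 ≤ P := nrm_nonneg _
  have hQ0 : 0 ≤ Q := nrm_nonneg _
  have hK : 0 ≤ nrm g * |h| := mul_nonneg (nrm_nonneg _) (abs_nonneg _)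
  -- From `P² + Q² ≤ ‖g‖ |h| P`: first bound `P` by dropping `Q²`, then use that bound on the right
  -- to control `Q`.
  have hP : P ≤ nrm g * |h| := by
    by_contra! hlt
    nlinarith [sq_nonneg Q]
  exact ⟨hP, abs_le_of_sq_le_sq' (by nlinarith) hK |>.2⟩

/-- The weak second angular derivative. -/
theorem HasWGrad.hasWeakDeriv_theta_theta {a : Cyl → ℝ} (hu : HasWGrad α u p q) (ha : MemL2 a)
    (h : ∀ φ, IsSmooth φ → ∫ z, p z * dTheta φ z ∂dz = -∫ z, a z * φ z ∂dz) :
    HasWeakDeriv 2 0 u a := by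
  refine ⟨hu.weak_theta.1, ha.locallyIntegrableOn, fun φ hφ => ?_⟩
  have e := hu.weak_theta.2.2 _ hφ.dTheta
  simp only [Function.iterate_one, Function.iterate_zero, id_eq, add_zero, pow_one,
    h φ hφ.1] at e
  simpa using e

/-- The weak mixed derivative. -/
theorem HasWGrad.hasWeakDeriv_theta_r {B : Cyl → ℝ} (hu : HasWGrad α u p q)
    (hb : MemL2 fun z => z.2 ^ (α / 2) * (z.2 ^ (-(α / 2)) * B z))
    (h : ∀ φ, IsSmooth φ →
      ∫ z, z.2 ^ (α / 2) * q z * dTheta φ z ∂dz = -∫ z, B z * φ z ∂dz) :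
    HasWeakDeriv 1 1 u fun z => z.2 ^ (-(α / 2)) * B z := by
  refine ⟨hu.weak_theta.1, locallyIntegrableOn_of_rpow_mul hb, fun φ hφ => ?_⟩
  have e := hu.weak_r.2.2 _ hφ.dTheta
  -- Testing with `r^(-α/2) φ` removes the weight: it is still smooth, and its radial factor
  -- commutes with `∂_θ`.
  have e1 := h _ (hφ.radial_mul (contDiffAt_rpow (-(α / 2)))).1
  simp only [dTheta_radial_mul (fun r => r ^ (-(α / 2)))] at e1
  have e2 : ∫ z, z.2 ^ (α / 2) * q z * (z.2 ^ (-(α / 2)) * dTheta φ z) ∂dz =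
      ∫ z, q z * dTheta φ z ∂dz := by
    refine integral_dz_congr fun z hz => ?_
    have e : z.2 ^ (α / 2) * z.2 ^ (-(α / 2)) = 1 := by
      rw [← Real.rpow_add (mem_Omega.1 hz).1]; simp
    linear_combination q z * dTheta φ z * e
  have e3 : ∀ z, B z * (z.2 ^ (-(α / 2)) * φ z) = z.2 ^ (-(α / 2)) * B z * φ z :=
    fun z => by ring
  rw [e2] at e1
  simp only [e3] at e1
  simp only [Function.iterate_one, Function.iterate_zero, id_eq, zero_add, pow_one, e1] at e
  simpa [dTheta_dR_comm hφ.1] using e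

/-- The weak second radial derivative, read off from the equation. -/
theorem IsWeakSolution.hasWeakDeriv_r_r (h0 : 0 ≤ α) (hg : MemL2 g)
    (hw : IsWeakSolution α g u) (hu : HasWGrad α u p q) {a : Cyl → ℝ} (ha : MemL2 a)
    (h : ∀ φ, IsSmooth φ → ∫ z, p z * dTheta φ z ∂dz = -∫ z, a z * φ z ∂dz)
    (hc : MemL2 fun z => z.2 ^ (1 + α / 2) *
      (-(z.2 ^ (-α) * (g z + a z)) - α * z.2 ^ (-1 : ℝ) * q z)) :
    HasWeakDeriv 0 2 u fun z => -(z.2 ^ (-α) * (g z + a z)) - α * z.2 ^ (-1 : ℝ) * q z := by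
  refine ⟨hu.weak_theta.1, locallyIntegrableOn_of_rpow_mul hc, fun φ hφ => ?_⟩
  have e := hu.weak_r.2.2 _ hφ.dR
  -- With `r^(-α) φ` as test function the radial energy becomes `q ∂_r φ - α r⁻¹ q φ`, which
  -- isolates the integral defining the second radial derivative.
  have hψ : IsTest fun z => z.2 ^ (-α) * φ z := hφ.radial_mul (contDiffAt_rpow (-α))
  have hχ : IsTest fun z => α * z.2 ^ (-1 : ℝ) * φ z :=
    hφ.radial_mul (χ := fun r => α * r ^ (-1 : ℝ))
      fun r hr => contDiffAt_const.mul (contDiffAt_rpow _ r hr)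
  have e1 := hw.eq_inner hu (hψ.isSmoothGamma.memH1Gamma h0) (hψ.1.hasWGrad h0)
  rw [h _ hψ.1] at e1
  have i1 := hu.memL2_r.integrable_mul_test hφ.dR
  have i2 := hu.memL2_r.integrable_mul_test hχ
  have e2 : ∫ z, (z.2 ^ (α / 2) * q z) *
      (z.2 ^ (α / 2) * dR (fun z => z.2 ^ (-α) * φ z) z) ∂dz =
      (∫ z, q z * dR φ z ∂dz) - ∫ z, q z * (α * z.2 ^ (-1 : ℝ) * φ z) ∂dz := by
    rw [← integral_sub i1 i2]
    refine integral_dz_congr fun z hz => ?_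
    have hz0 := (mem_Omega.1 hz).1
    rw [hφ.1.dR_rpow_mul _ hz]
    have r1 : z.2 ^ (α / 2) * z.2 ^ (α / 2) * z.2 ^ (-α) = 1 := by
      rw [← Real.rpow_add hz0, ← Real.rpow_add hz0]; simp
    have r2 : z.2 ^ (-α - 1) = z.2 ^ (-α) * z.2 ^ (-1 : ℝ) := by
      rw [← Real.rpow_add hz0]; rfl
    rw [r2]
    linear_combination (q z * dR φ z - α * q z * z.2 ^ (-1 : ℝ) * φ z) * r1
  have e3 : ∫ z, (-(z.2 ^ (-α) * (g z + a z)) - α * z.2 ^ (-1 : ℝ) * q z) * φ z ∂dz =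
      -(∫ z, g z * (z.2 ^ (-α) * φ z) ∂dz) - (∫ z, a z * (z.2 ^ (-α) * φ z) ∂dz)
        - ∫ z, q z * (α * z.2 ^ (-1 : ℝ) * φ z) ∂dz := by
    have i3 : Integrable (fun z => -(g z * (z.2 ^ (-α) * φ z))) dz :=
      (hg.integrable_mul hψ.1.memL2).neg
    have i4 := ha.integrable_mul hψ.1.memL2
    have i5 : Integrable (fun z => -(g z * (z.2 ^ (-α) * φ z)) - a z * (z.2 ^ (-α) * φ z)) dz :=
      i3.sub i4
    rw [← integral_neg, ← integral_sub i3 i4]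
    refine Eq.trans ?_ (integral_sub i5 i2)
    congr 1
    ext z
    ring
  simp only [Function.iterate_one, Function.iterate_zero, id_eq, zero_add, pow_one] at e
  simp only [Function.iterate_zero, id_eq, zero_add, even_two, Even.neg_pow, one_pow, one_mul,
    Function.iterate_succ, Function.comp_apply]
  linarith

end WeakSolution

end DegenerateElliptic

/-! ### The second-order estimate -/

open DegenerateElliptic in
theorem theorem2p20 (α : ℝ) (hα1 : 1 ≤ α) (hα2 : α < 2) :
    ∃ C : ℝ, 0 < C ∧ ∀ g u : Cyl → ℝ, MemL2 g → IsWeakSolution α g u →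
      ∃ a b c : Cyl → ℝ,
        HasWeakDeriv 2 0 u a ∧ HasWeakDeriv 1 1 u b ∧ HasWeakDeriv 0 2 u c ∧
        MemL2 a ∧
        MemL2 (fun z => z.2 ^ (α / 2) * b z) ∧
        MemL2 (fun z => z.2 ^ (1 + α / 2) * c z) ∧
        ∫ z, ((a z) ^ 2 + z.2 ^ α * (b z) ^ 2 + z.2 ^ (2 + α) * (c z) ^ 2) ∂dz
          ≤ C * ∫ z, (g z) ^ 2 ∂dz := by
  have h0 : 0 ≤ α := by linarith
  -- `38 = 1 + 1 + 6²`: the angular and mixed terms have norm at most `‖g‖`, the radial term at most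
  -- `6 ‖g‖`.
  refine ⟨38, by norm_num, fun g u hg hw => ?_⟩
  obtain ⟨p, q, hu, happ⟩ := hw.memH1Gamma
  have hdiff := hw.nrm_rot_sub_le h0 hg hu happ
  obtain ⟨a, ha, hag, haw⟩ :=
    hu.memL2_theta.exists_weak_dTheta (nrm_nonneg g) fun h => (hdiff h).1
  obtain ⟨B, hB, hBg, hBw⟩ := hu.memL2_r.exists_weak_dTheta (nrm_nonneg g) fun h => (hdiff h).2
  have hq := hw.nrm_r_le h0 hα2.le hg hu happ
  have eb : ∀ z ∈ Omega, B z = z.2 ^ (α / 2) * (z.2 ^ (-(α / 2)) * B z) := fun z hz => by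
    rw [← mul_assoc, ← Real.rpow_add (mem_Omega.1 hz).1]; simp
  have hb := hB.congr eb
  -- The exponent left after multiplying `r^(-α)` by `r^(1+α/2)`; it is nonnegative because `α < 2`.
  have hga := (hg.add ha).rpow_mul (by linarith : 0 ≤ 1 - α / 2)
  have ec : ∀ z ∈ Omega,
      -(z.2 ^ (1 - α / 2) * (g z + a z)) - α * (z.2 ^ (α / 2) * q z) =
        z.2 ^ (1 + α / 2) * (-(z.2 ^ (-α) * (g z + a z)) - α * z.2 ^ (-1 : ℝ) * q z) := by
    intro z hz
    have hz0 := (mem_Omega.1 hz).1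
    have r1 : z.2 ^ (1 - α / 2) = z.2 ^ (1 + α / 2) * z.2 ^ (-α) := by
      rw [← Real.rpow_add hz0]; ring_nf
    have r2 : z.2 ^ (α / 2) = z.2 ^ (1 + α / 2) * z.2 ^ (-1 : ℝ) := by
      rw [← Real.rpow_add hz0]; ring_nf
    rw [r1, r2]
    ring
  have hc' := hga.neg.sub (hu.memL2_r.const_mul α)
  have hc := hc'.congr ec
  refine ⟨a, _, _, hu.hasWeakDeriv_theta_theta ha haw, hu.hasWeakDeriv_theta_r hb hBw,
    hw.hasWeakDeriv_r_r h0 hg hu ha haw hc, ha, hb, hc, ?_⟩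
  -- `g` and `a` contribute at most `2 ‖g‖`, and the first-order term at most `α · 2 ‖g‖ ≤ 4 ‖g‖`.
  have hcn : nrm (fun z => -(z.2 ^ (1 - α / 2) * (g z + a z)) - α * (z.2 ^ (α / 2) * q z)) ≤
      6 * nrm g := by
    have n1 := hga.neg.nrm_sub_le (g := fun z => α * (z.2 ^ (α / 2) * q z))
    have n2 : nrm (fun z => -(z.2 ^ (1 - α / 2) * (g z + a z))) =
      nrm (fun z => z.2 ^ (1 - α / 2) * (g z + a z)) := lpNorm_neg _ 2 dz
    have n3 := (hg.add ha).nrm_rpow_mul_le (by linarith : 0 ≤ 1 - α / 2)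
    have n4 : nrm (fun z => g z + a z) ≤ nrm g + nrm a := lpNorm_add_le hg (by norm_num)
    rw [n2, nrm_const_mul hu.memL2_r, abs_of_nonneg h0] at n1
    nlinarith [nrm_nonneg g, nrm_nonneg fun z => z.2 ^ (α / 2) * q z]
  have hsum : Integrable (fun z => a z ^ 2 + B z ^ 2) dz := ha.integrable_sq.add hB.integrable_sq
  calc _ = ∫ z, (a z ^ 2 + B z ^ 2 +
        (-(z.2 ^ (1 - α / 2) * (g z + a z)) - α * (z.2 ^ (α / 2) * q z)) ^ 2) ∂dz := by
        refine integral_dz_congr fun z hz => ?_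
        have hz0 := (mem_Omega.1 hz).1
        have r1 : z.2 ^ α = (z.2 ^ (α / 2)) ^ 2 := by
          rw [← Real.rpow_mul_natCast hz0.le]; norm_num
        have r2 : z.2 ^ (2 + α) = (z.2 ^ (1 + α / 2)) ^ 2 := by
          rw [← Real.rpow_mul_natCast hz0.le]; ring_nf
        rw [ec z hz, r1, r2, ← mul_pow, ← mul_pow, ← eb z hz]
    _ = nrm a ^ 2 + nrm B ^ 2 + nrm (fun z => -(z.2 ^ (1 - α / 2) * (g z + a z))
          - α * (z.2 ^ (α / 2) * q z)) ^ 2 := by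
        rw [integral_add hsum hc'.integrable_sq, integral_add ha.integrable_sq hB.integrable_sq,
          ha.nrm_sq, hB.nrm_sq, hc'.nrm_sq]
    _ ≤ nrm g ^ 2 + nrm g ^ 2 + (6 * nrm g) ^ 2 := by
        have := nrm_nonneg a
        have := nrm_nonneg B
        have := nrm_nonneg (fun z => -(z.2 ^ (1 - α / 2) * (g z + a z))
          - α * (z.2 ^ (α / 2) * q z))
        gcongr
    _ = 38 * ∫ z, g z ^ 2 ∂dz := by rw [← hg.nrm_sq]; ring
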